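/- **Setting (MNL bandits under a risk criterion).** Let $N,T\ge 1$ and $0\le K\le N$ be integers. Product $i\in[N]=\{1,\dots,N\}$ has a known profit $r_i\in(0,1]$ and an unknown preference parameter $v_i\in[0,1]$; no purchase is choice $0$, with profit $r_0=0$ and preference parameter $1$. For $\mathbf{u}\in[0,\infty)^N$ and $S\subseteq[N]$, let $F(S,\mathbf{u})$ be the cumulative distribution function of the profit of one step: $0$ with probability $\frac1{1+\sum_{j\in S}u_j}$ (no purchase), and $r_i$ with probability $\frac{u_i}{1+\sum_{j\in S}u_j}$ for each $i\in S$ (purchase of $i$; probabilities of equal profits are added). At each time $t=1,\dots,T$ the decision maker displays an assortment $S_t\subseteq[N]$ with $|S_t|\le K$ depending on $c_1,\dots,c_{t-1}$, and then observes $c_t\in S_t\cup\{0\}$, whose conditional law given the past is $\Pr(c_t=i)=\frac{v_i}{1+\sum_{j\in S_t}v_j}$, with $v_0=1$. Let $\mathcal D[0,1]$ be the set of cumulative distribution functions of random variables with values in $[0,1]$, and let $U$ be a real-valued function on it. The regret is $$\mathfrak R_T=T\max_{|S|\le K}U(F(S,\mathbf{v}))-\mathbb E\Big[\sum_{t=1}^T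 U(F(S_t,\mathbf{v}))\Big].$$ **Assumptions on $U$** (with constants $\gamma_1$ and $\gamma_2\ge0$). 1. Quasiconvexity: $U(\lambda F_1+(1-\lambda)F_2)\le\max\{U(F_1),U(F_2)\}$ for all $\lambda\in[0,1]$ and $F_1,F_2\in\mathcal D[0,1]$. 2. Boundedness: $|U(F)|\le\gamma_1$ for all $F\in\mathcal D[0,1]$. 3. One-sided Lipschitz condition: $U(F(S,\mathbf{u}'))-U(F(S,\mathbf{u}))\le\frac{\gamma_2}{1+\sum_{i\in S}u_i}\sum_{i\in S}(u_i'-u_i)$ for all $S\subseteq[N]$ and $\mathbf{u},\mathbf{u}'\in[0,1]^N$ with $\mathbf{u}'\ge\mathbf{u}$ coordinatewise. **Algorithm RiskAwareUCB.** Time is divided into episodes $\ell=1,2,\dots$. Throughout episode $\ell$ the same assortment $S_\ell\in\operatorname{argmax}_{|S|\le K}U(F(S,\tilde{\mathbf{v}}^\ell))$ is displayed (ties are broken arbitrarily); the episode ends with the first no-purchase, or when $T$ steps have been made. Let $T_i(\ell)$ be the number of episodes $\ell'<\ell$ with $i\in S_{\ell'}$, and $\bar v_i^\ell$ the total number of purchases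 of $i$ in these episodes divided by $T_i(\ell)$. Then $$\tilde v_i^\ell=\min\Big\{\bar v_i^\ell+\sqrt{\bar v_i^\ell\,\tfrac{48\ln(\sqrt N\ell+1)}{T_i(\ell)}}+\tfrac{48\ln(\sqrt N\ell+1)}{T_i(\ell)},\,1\Big\}\quad\text{if }T_i(\ell)\ge1,\qquad\tilde v_i^\ell=1\quad\text{if }T_i(\ell)=0.$$ **Theorem.** There are absolute constants $C_1,C_2,C>0$ and $k\in\mathbb N$ such that for all $N,K,T,\mathbf{r},\mathbf{v},U,\gamma_1,\gamma_2$ as above and every way of breaking ties, the regret of RiskAwareUCB satisfies $$\mathfrak R_T\le 2\gamma_1(N+1)(\ln T+\gamma)+\gamma_2C_1\sqrt{\ln(\sqrt N\,T+1)}\,\big(2\sqrt{NT}+N\big)+\gamma_2C_2\ln(\sqrt N\,T+1)\,\big(N\ln T+N(1+\gamma)\big),$$ where $\gamma$ is Euler's constant, and $$\mathfrak R_T\le C(\gamma_1+\gamma_2)\sqrt{NT}\,\big(1+\ln(NT)\big)^k,$$ that is, $\mathfrak R_T=\tilde{\mathcal O}(\sqrt{NT})$. -/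

import Mathlib

open Finset

noncomputable section

namespace MNLBandit

/-- What is observed in one time step: `none` is no purchase, `some i` is the purchase of
product `i`. -/
abbrev Choice (N : ℕ) := Option (Fin N)

/-- The multinomial logit probabilities of the choices when the assortment `S` is displayed and
the preference parameters are `v` (no-purchase has preference parameter `1`). -/
def choiceProb {N : ℕ} (v : Fin N → ℝ) (S : Finset (Fin N)) : Choice N → ℝ
  | none => 1 / (1 + ∑ j ∈ S, v j)
  | some i => if i ∈ S then v i / (1 + ∑ j ∈ S, v j) else 0

/-- The profit earned from a choice: `r i` for product `i`, and `0` for no purchase. -/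
def profit {N : ℕ} (r : Fin N → ℝ) : Choice N → ℝ
  | none => 0
  | some i => r i

/-- `F(S, v)`: the cumulative distribution function of the profit of one time step, when `S` is
displayed and the preference parameters are `v`. -/
def profitCDF {N : ℕ} (r v : Fin N → ℝ) (S : Finset (Fin N)) : ℝ → ℝ :=
  fun x => ∑ c : Choice N, if profit r c ≤ x then choiceProb v S c else 0

/-- `𝒟[0,1]`: the cumulative distribution functions of random variables with values in
`[0,1]`. -/
def cdfUnit : Set (ℝ → ℝ) :=
  {F | ∃ μ : MeasureTheory.Measure ℝ, MeasureTheory.IsProbabilityMeasure μ ∧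
    μ (Set.Icc 0 1) = 1 ∧ ∀ x, F x = ProbabilityTheory.cdf μ x}

/-! A risk criterion is a function `U : (ℝ → ℝ) → ℝ`, used only on `cdfUnit`. -/

/-- `U` is quasiconvex on `𝒟[0,1]`. -/
def RiskQuasiconvex (U : (ℝ → ℝ) → ℝ) : Prop :=
  ∀ F₁ ∈ cdfUnit, ∀ F₂ ∈ cdfUnit, ∀ a : ℝ, 0 ≤ a → a ≤ 1 →
    U (a • F₁ + (1 - a) • F₂) ≤ max (U F₁) (U F₂)

/-- `U` is bounded by `γ₁` on `𝒟[0,1]`. -/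
def RiskBounded (U : (ℝ → ℝ) → ℝ) (γ₁ : ℝ) : Prop :=
  ∀ F ∈ cdfUnit, |U F| ≤ γ₁

/-- The one-sided Lipschitz condition in the preference parameters (which lie in `[0,1]`). -/
def RiskLipschitz {N : ℕ} (U : (ℝ → ℝ) → ℝ) (r : Fin N → ℝ) (γ₂ : ℝ) : Prop :=
  ∀ (v v' : Fin N → ℝ) (S : Finset (Fin N)),
    (∀ i, 0 ≤ v i) → (∀ i, v i ≤ v' i) → (∀ i, v' i ≤ 1) →
      U (profitCDF r v' S) - U (profitCDF r v S)
        ≤ γ₂ / (1 + ∑ i ∈ S, v i) * ∑ i ∈ S, (v' i - v i)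

/-- The assortments that may be displayed: at most `K` of the `N` products. -/
def assortments (N K : ℕ) : Finset (Finset (Fin N)) :=
  Finset.univ.filter fun S => S.card ≤ K

theorem assortments_nonempty (N K : ℕ) : (assortments N K).Nonempty :=
  ⟨∅, by simp [assortments]⟩

/-- The value `U(F(S*, v)) = max_{|S| ≤ K} U(F(S, v))` of an optimal assortment. -/
def optValue {N : ℕ} (U : (ℝ → ℝ) → ℝ) (r v : Fin N → ℝ) (K : ℕ) : ℝ :=
  (assortments N K).sup' (assortments_nonempty N K) fun S => U (profitCDF r v S)

/-! ### Policies and regret -/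

/-- The choices observed so far, the latest first. -/
abbrev History (N : ℕ) := List (Choice N)

/-- A policy displays an assortment that depends on the choices observed so far. -/
abbrev Policy (N : ℕ) := History N → Finset (Fin N)

/-- The history before time step `t` (counted from `0`) on the trajectory `ω`. -/
def past {N T : ℕ} (ω : Fin T → Choice N) (t : Fin T) : History N :=
  ((List.ofFn ω).take t).reverse

/-- The probability that the choices of the first `T` time steps are `ω` when the policy `π` is
used: given the past, each choice follows the logit model for the assortment displayed. -/
def trajProb {N T : ℕ} (v : Fin N → ℝ) (π : Policy N) (ω : Fin T → Choice N) : ℝ :=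
  ∏ t : Fin T, choiceProb v (π (past ω t)) (ω t)

/-- The regret after `T` time steps, `T U(F(S*, v)) - E[∑_{t ≤ T} U(F(S_t, v))]`. -/
def regret {N : ℕ} (U : (ℝ → ℝ) → ℝ) (r v : Fin N → ℝ) (K T : ℕ) (π : Policy N) : ℝ :=
  T * optValue U r v K
    - ∑ ω : Fin T → Choice N,
        trajProb v π ω * ∑ t : Fin T, U (profitCDF r v (π (past ω t)))

/-! ### The algorithm `RiskAwareUCB` -/

/-- The optimistic estimate of a preference parameter in episode `ℓ`, for a product that was
served in `n` earlier episodes and sold `m` times in these. It is `1` for a product that was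
never served. -/
def optimisticEstimate (N ℓ n m : ℕ) : ℝ :=
  if n = 0 then 1
  else
    min ((m : ℝ) / n
        + √((m : ℝ) / n * (48 * Real.log (√(N : ℝ) * ℓ + 1) / n))
        + 48 * Real.log (√(N : ℝ) * ℓ + 1) / n) 1

/-- The variables of the algorithm. -/
structure UCBState (N : ℕ) where
  /-- the number `ℓ ≥ 1` of the current episode -/
  episode : ℕ
  /-- the assortment `S_ℓ` displayed throughout the current episode -/
  offer : Finset (Fin N)
  /-- `t_{i,ℓ}`: how often product `i` has been bought in the current episode -/
  sales : Fin N → ℕ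
  /-- `T_i(ℓ)`: the number of earlier episodes in which product `i` was served -/
  served : Fin N → ℕ
  /-- the sum of `t_{i,ℓ'}` over the earlier episodes `ℓ'` in which product `i` was served -/
  sold : Fin N → ℕ

/-- A way to choose the assortment from the estimates; how it breaks ties may depend on the
history. -/
abbrev SelectionRule (N : ℕ) := History N → (Fin N → ℝ) → Finset (Fin N)

/-- The selection rule always returns an element of `argmax_{|S| ≤ K} U(F(S, u))`. -/
def IsArgmaxRule {N : ℕ} (U : (ℝ → ℝ) → ℝ) (r : Fin N → ℝ) (K : ℕ)
    (σ : SelectionRule N) : Prop :=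
  ∀ (h : History N) (u : Fin N → ℝ), σ h u ∈ assortments N K ∧
    ∀ S ∈ assortments N K, U (profitCDF r u S) ≤ U (profitCDF r u (σ h u))

/-- The start of episode `ℓ`, after the history `h`. -/
def startEpisode {N : ℕ} (σ : SelectionRule N) (h : History N) (ℓ : ℕ)
    (served sold : Fin N → ℕ) : UCBState N where
  episode := ℓ
  offer := σ h fun i => optimisticEstimate N ℓ (served i) (sold i)
  sales := fun _ => 0
  served := served
  sold := sold

/-- The state of the algorithm after the history `h`. A purchase is counted and the episode goes
on; no purchase ends the episode: the statistics of the products just served are updated and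
the next episode starts. -/
def ucbState {N : ℕ} (σ : SelectionRule N) : History N → UCBState N
  | [] => startEpisode σ [] 1 (fun _ => 0) (fun _ => 0)
  | some i :: h =>
      let s := ucbState σ h
      { s with sales := fun j => if j = i then s.sales j + 1 else s.sales j }
  | none :: h =>
      let s := ucbState σ h
      startEpisode σ (none :: h) (s.episode + 1)
        (fun i => if i ∈ s.offer then s.served i + 1 else s.served i)
        (fun i => if i ∈ s.offer then s.sold i + s.sales i else s.sold i)

/-- The policy `RiskAwareUCB` with a given selection rule. -/
def riskAwareUCB {N : ℕ} (σ : SelectionRule N) : Policy N :=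
  fun h => (ucbState σ h).offer

end MNLBandit

end

namespace MNLBandit

theorem one_add_sum_pos {N : ℕ} {v : Fin N → ℝ} (hv : ∀ i, 0 ≤ v i) (S : Finset (Fin N)) :
    0 < 1 + ∑ j ∈ S, v j := by
  have := Finset.sum_nonneg fun j (_ : j ∈ S) => hv j
  linarith

theorem choiceProb_nonneg {N : ℕ} {v : Fin N → ℝ} (hv : ∀ i, 0 ≤ v i) (S : Finset (Fin N))
    (c : Choice N) : 0 ≤ choiceProb v S c := by
  have hD := (one_add_sum_pos hv S).le
  cases c with
  | none => exact div_nonneg zero_le_one hD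
  | some i =>
    simp only [choiceProb]
    split_ifs
    · exact div_nonneg (hv i) hD
    · exact le_rfl

/-- The mean of `f` under the logit model. -/
theorem sum_choiceProb_mul {N : ℕ} (v : Fin N → ℝ) (S : Finset (Fin N)) (f : Choice N → ℝ) :
    ∑ c, choiceProb v S c * f c
      = (f none + ∑ i ∈ S, v i * f (some i)) / (1 + ∑ j ∈ S, v j) := by
  rw [Fintype.sum_option, add_div, Finset.sum_div, ← Finset.sum_subset (Finset.subset_univ S)]
  · congr 1
    · simp only [choiceProb]; ring
    · refine Finset.sum_congr rfl fun i hi => ?_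
      simp only [choiceProb, if_pos hi]; ring
  · intro i _ hi
    simp [choiceProb, hi]

theorem sum_choiceProb {N : ℕ} {v : Fin N → ℝ} (hv : ∀ i, 0 ≤ v i) (S : Finset (Fin N)) :
    ∑ c, choiceProb v S c = 1 := by
  have h := sum_choiceProb_mul v S fun _ => 1
  simp only [mul_one] at h
  rw [h, div_self (one_add_sum_pos hv S).ne']

/-- The expected total cost of the next `m` steps after the history `h`, when the cost of a step
is a function of the history before it. -/
noncomputable def expectedTotal {N : ℕ} (v : Fin N → ℝ) (π : Policy N) (c : History N → ℝ) :
    ℕ → History N → ℝ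
  | 0, _ => 0
  | m + 1, h => c h + ∑ x, choiceProb v (π h) x * expectedTotal v π c m (x :: h)

theorem past_cons_zero {N m : ℕ} (x : Choice N) (ω : Fin m → Choice N) :
    past (Fin.cons x ω : Fin (m + 1) → Choice N) 0 = [] := by
  simp [past]

theorem past_cons_succ {N m : ℕ} (x : Choice N) (ω : Fin m → Choice N) (t : Fin m) :
    past (Fin.cons x ω : Fin (m + 1) → Choice N) t.succ = past ω t ++ [x] := by
  simp [past, List.ofFn_succ]

theorem sum_traj_succ {N m : ℕ} (F : (Fin (m + 1) → Choice N) → ℝ) :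
    ∑ ω, F ω = ∑ x, ∑ ω : Fin m → Choice N, F (Fin.cons x ω) := by
  rw [← Fintype.sum_prod_type']
  exact (Equiv.sum_comp (Fin.consEquiv fun _ : Fin (m + 1) => Choice N) F).symm

theorem sum_trajProb_from {N : ℕ} {v : Fin N → ℝ} (hv : ∀ i, 0 ≤ v i) (π : Policy N) (m : ℕ) :
    ∀ h : History N, ∑ ω : Fin m → Choice N,
      ∏ t, choiceProb v (π (past ω t ++ h)) (ω t) = 1 := by
  induction m with
  | zero => intro h; simp
  | succ m ih =>
    intro h
    rw [sum_traj_succ, ← sum_choiceProb hv (π h)]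
    refine Finset.sum_congr rfl fun x _ => ?_
    simp only [Fin.prod_univ_succ, past_cons_zero, past_cons_succ, Fin.cons_zero, Fin.cons_succ,
      List.append_assoc, List.nil_append, List.singleton_append, ← Finset.mul_sum]
    rw [ih, mul_one]

theorem sum_trajProb_mul_sum_from {N : ℕ} {v : Fin N → ℝ} (hv : ∀ i, 0 ≤ v i) (π : Policy N)
    (c : History N → ℝ) (m : ℕ) :
    ∀ h : History N, ∑ ω : Fin m → Choice N,
      (∏ t, choiceProb v (π (past ω t ++ h)) (ω t)) * ∑ t, c (past ω t ++ h)
        = expectedTotal v π c m h := by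
  induction m with
  | zero => intro h; simp [expectedTotal]
  | succ m ih =>
    intro h
    rw [sum_traj_succ, expectedTotal]
    have hc : c h = ∑ x, choiceProb v (π h) x * c h := by
      rw [← Finset.sum_mul, sum_choiceProb hv, one_mul]
    rw [hc, ← Finset.sum_add_distrib]
    refine Finset.sum_congr rfl fun x _ => ?_
    simp only [Fin.prod_univ_succ, Fin.sum_univ_succ, past_cons_zero, past_cons_succ,
      Fin.cons_zero, Fin.cons_succ, List.append_assoc, List.nil_append, List.singleton_append,
      mul_assoc, ← Finset.mul_sum, mul_add, Finset.sum_add_distrib]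
    rw [ih, ← Finset.sum_mul, sum_trajProb_from hv, one_mul]

theorem regret_eq_expectedTotal {N : ℕ} (U : (ℝ → ℝ) → ℝ) (r : Fin N → ℝ) {v : Fin N → ℝ}
    (hv : ∀ i, 0 ≤ v i) (K T : ℕ) (π : Policy N) :
    regret U r v K T π
      = expectedTotal v π (fun h => optValue U r v K - U (profitCDF r v (π h))) T [] := by
  rw [← sum_trajProb_mul_sum_from hv]
  have h1 := sum_trajProb_from hv π T []
  simp only [List.append_nil] at h1 ⊢
  simp only [Finset.sum_sub_distrib, mul_sub, Finset.sum_const, Finset.card_univ,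
    Fintype.card_fin, nsmul_eq_mul]
  rw [← Finset.sum_mul, h1, one_mul]
  rfl

theorem expectedTotal_sum {N : ℕ} (v : Fin N → ℝ) (π : Policy N) {ι : Type*} (s : Finset ι)
    (c : ι → History N → ℝ) (m : ℕ) :
    ∀ h, expectedTotal v π (fun h => ∑ a ∈ s, c a h) m h
      = ∑ a ∈ s, expectedTotal v π (c a) m h := by
  induction m with
  | zero => intro h; simp [expectedTotal]
  | succ m ih =>
    intro h
    simp only [expectedTotal, ih, Finset.sum_add_distrib, Finset.mul_sum]
    rw [Finset.sum_comm]

theorem expectedTotal_add {N : ℕ} (v : Fin N → ℝ) (π : Policy N) (c c' : History N → ℝ)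
    (m : ℕ) : ∀ h, expectedTotal v π (fun h => c h + c' h) m h
      = expectedTotal v π c m h + expectedTotal v π c' m h := by
  induction m with
  | zero => intro h; simp [expectedTotal]
  | succ m ih =>
    intro h
    simp only [expectedTotal, ih, mul_add, Finset.sum_add_distrib]
    ring

theorem expectedTotal_mul {N : ℕ} (v : Fin N → ℝ) (π : Policy N) (a : ℝ) (c : History N → ℝ)
    (m : ℕ) : ∀ h, expectedTotal v π (fun h => a * c h) m h = a * expectedTotal v π c m h := by
  induction m with
  | zero => intro h; simp [expectedTotal]
  | succ m ih =>
    intro h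
    simp only [expectedTotal, ih, mul_add, Finset.mul_sum]
    congr 1
    exact Finset.sum_congr rfl fun x _ => by ring

/-- A potential whose expected decrease pays for the cost of each step bounds the expected total
cost. -/
theorem expectedTotal_le_of_potential {N : ℕ} {v : Fin N → ℝ} (hv : ∀ i, 0 ≤ v i)
    (π : Policy N) (c : History N → ℝ) (Φ : ℕ → History N → ℝ) (T : ℕ)
    (h_zero : ∀ h, h.length = T → 0 ≤ Φ 0 h)
    (h_step : ∀ m h, h.length + m + 1 = T →
      c h + ∑ x, choiceProb v (π h) x * Φ m (x :: h) ≤ Φ (m + 1) h) (m : ℕ) :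
    ∀ h, h.length + m = T → expectedTotal v π c m h ≤ Φ m h := by
  induction m with
  | zero => exact h_zero
  | succ m ih =>
    intro h hT
    refine le_trans ?_ (h_step m h hT)
    rw [expectedTotal]
    gcongr with x
    · exact choiceProb_nonneg hv _ _
    · exact ih _ (by simp only [List.length_cons]; omega)

theorem expectedTotal_mono {N : ℕ} {v : Fin N → ℝ} (hv : ∀ i, 0 ≤ v i) (π : Policy N)
    {c c' : History N → ℝ} {T : ℕ} (hc : ∀ h : History N, h.length < T → c h ≤ c' h) :
    expectedTotal v π c T [] ≤ expectedTotal v π c' T [] := by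
  refine expectedTotal_le_of_potential hv π c (expectedTotal v π c') T (fun _ _ => le_rfl)
    (fun m h hT => ?_) T [] (by simp)
  rw [expectedTotal]
  have := hc h (by omega)
  linarith

theorem expectedTotal_le_of_cost_le {N : ℕ} {v : Fin N → ℝ} (hv : ∀ i, 0 ≤ v i) (π : Policy N)
    {c : History N → ℝ} {a : ℝ} (hc : ∀ h, c h ≤ a) (T : ℕ) :
    expectedTotal v π c T [] ≤ T * a := by
  refine expectedTotal_le_of_potential hv π c (fun m _ => m * a) T (fun _ _ => by simp)
    (fun m h _ => ?_) T [] (by simp)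
  rw [← Finset.sum_mul, sum_choiceProb hv]
  have := hc h
  push_cast
  linarith

theorem profitCDF_mem_cdfUnit {N : ℕ} {r v : Fin N → ℝ} (hr : ∀ i, 0 ≤ r i ∧ r i ≤ 1)
    (hv : ∀ i, 0 ≤ v i) (S : Finset (Fin N)) : profitCDF r v S ∈ cdfUnit := by
  have hp : ∀ c, 0 ≤ profit r c ∧ profit r c ≤ 1 := by
    rintro (_ | i)
    · simp [profit]
    · exact hr i
  have h_apply : ∀ A : Set ℝ, MeasurableSet A →
      (∑ c : Choice N, ENNReal.ofReal (choiceProb v S c) •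
        MeasureTheory.Measure.dirac (profit r c)) A
        = ENNReal.ofReal (∑ c : Choice N, A.indicator (fun _ => choiceProb v S c)
            (profit r c)) := by
    intro A hA
    rw [MeasureTheory.Measure.finsetSum_apply, ENNReal.ofReal_sum_of_nonneg]
    · refine Finset.sum_congr rfl fun c _ => ?_
      rw [MeasureTheory.Measure.smul_apply, MeasureTheory.Measure.dirac_apply' _ hA]
      by_cases h : profit r c ∈ A <;> simp [h]
    · exact fun c _ => Set.indicator_nonneg (fun _ _ => choiceProb_nonneg hv S c) _
  have h_univ : (∑ c : Choice N, ENNReal.ofReal (choiceProb v S c) •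
        MeasureTheory.Measure.dirac (profit r c)) Set.univ = 1 := by
    rw [h_apply _ MeasurableSet.univ]
    simp [sum_choiceProb hv]
  have h_prob : MeasureTheory.IsProbabilityMeasure
      (∑ c : Choice N, ENNReal.ofReal (choiceProb v S c) •
        MeasureTheory.Measure.dirac (profit r c)) := ⟨h_univ⟩
  refine ⟨_, h_prob, ?_, fun x => ?_⟩
  · rw [h_apply _ measurableSet_Icc]
    have : ∀ c, profit r c ∈ Set.Icc (0 : ℝ) 1 := fun c => ⟨(hp c).1, (hp c).2⟩
    simp [Set.indicator_of_mem (this _), sum_choiceProb hv]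
  · rw [ProbabilityTheory.cdf_eq_real, MeasureTheory.measureReal_def,
      h_apply _ measurableSet_Iic, ENNReal.toReal_ofReal]
    · simp [profitCDF, Set.indicator_apply]
    · exact Finset.sum_nonneg fun c _ =>
        Set.indicator_nonneg (fun _ _ => choiceProb_nonneg hv S c) _

theorem profitCDF_congr {N : ℕ} (r : Fin N → ℝ) {u w : Fin N → ℝ} {S : Finset (Fin N)}
    (h : ∀ i ∈ S, u i = w i) : profitCDF r u S = profitCDF r w S := by
  have : choiceProb u S = choiceProb w S := by
    funext c
    cases c with
    | none => simp only [choiceProb]; rw [Finset.sum_congr rfl h]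
    | some i =>
      simp only [choiceProb]
      split_ifs with hi
      · rw [Finset.sum_congr rfl h, h i hi]
      · rfl
  funext y
  simp only [profitCDF, this]

/-- Lowering one preference parameter gives a mixture of the original profit distribution and
of that of the assortment without the product. -/
theorem profitCDF_update_eq_mixture {N : ℕ} (r : Fin N → ℝ) {w : Fin N → ℝ}
    (hw : ∀ i, 0 ≤ w i) {S : Finset (Fin N)} {i : Fin N} (hi : i ∈ S) {x : ℝ} (hx : 0 < x)
    (hxw : w i ≤ x) :
    ∃ a : ℝ, 0 ≤ a ∧ a ≤ 1 ∧ profitCDF r w S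
      = a • profitCDF r (Function.update w i x) S
        + (1 - a) • profitCDF r (Function.update w i x) (S.erase i) := by
  set R : ℝ := 1 + ∑ j ∈ S.erase i, w j with hR
  have hR0 : 0 < R := one_add_sum_pos hw _
  have hwi := hw i
  have hD : 1 + ∑ j ∈ S, w j = R + w i := by
    rw [← Finset.sum_erase_add S w hi]; ring
  have hE : ∑ j ∈ S.erase i, Function.update w i x j = ∑ j ∈ S.erase i, w j :=
    Finset.sum_congr rfl fun j hj => Function.update_of_ne (Finset.ne_of_mem_erase hj) _ _
  have hD' : 1 + ∑ j ∈ S, Function.update w i x j = R + x := by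
    rw [← Finset.sum_erase_add S _ hi, hE, Function.update_self]; ring
  have h1 : R + w i ≠ 0 := by positivity
  have h2 : R + x ≠ 0 := by positivity
  have ha : 1 - w i * (R + x) / (x * (R + w i)) = (x - w i) * R / (x * (R + w i)) := by
    field_simp; ring
  refine ⟨w i * (R + x) / (x * (R + w i)), by positivity, ?_, ?_⟩
  · rw [← sub_nonneg, ha]
    have := sub_nonneg.2 hxw
    positivity
  · rw [ha]
    funext y
    simp only [profitCDF, Pi.add_apply, Pi.smul_apply, smul_eq_mul, Finset.mul_sum,
      ← Finset.sum_add_distrib]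
    refine Finset.sum_congr rfl fun c _ => ?_
    split_ifs
    · cases c with
      | none =>
        simp only [choiceProb, hD, hD', hE, ← hR]
        field_simp
        ring
      | some j =>
        simp only [choiceProb, hD, hD', hE, ← hR, Finset.mem_erase]
        by_cases hj : j = i
        · subst hj
          simp only [hi, Function.update_self]
          simp
          field_simp
        · by_cases hjS : j ∈ S
          · simp only [hj, hjS, Function.update_of_ne hj, if_true, ne_eq, not_false_eq_true,
              and_self]
            field_simp
            ring
          · simp [hjS]
    · simp

/-- Under a quasiconvex criterion, larger preference parameters do as well with a smaller
assortment. -/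
theorem exists_subset_le_of_le {N : ℕ} {U : (ℝ → ℝ) → ℝ} (hU : RiskQuasiconvex U)
    {r : Fin N → ℝ} (hr : ∀ i, 0 ≤ r i ∧ r i ≤ 1) {v u : Fin N → ℝ} (hv : ∀ i, 0 ≤ v i)
    (hvu : ∀ i, v i ≤ u i) (A S : Finset (Fin N)) :
    ∃ S' ⊆ S, U (profitCDF r v S)
      ≤ U (profitCDF r (fun j => if j ∈ A then u j else v j) S') := by
  induction A using Finset.induction_on with
  | empty => exact ⟨S, subset_rfl, by simp⟩
  | insert i A hiA ih =>
    obtain ⟨S', hS', hle⟩ := ih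
    have hw : ∀ j, 0 ≤ if j ∈ A then u j else v j := fun j => by
      split_ifs
      · exact (hv j).trans (hvu j)
      · exact hv j
    have hup : (fun j => if j ∈ insert i A then u j else v j)
        = Function.update (fun j => if j ∈ A then u j else v j) i (u i) := by
      funext j
      by_cases hj : j = i
      · subst hj; simp
      · simp [hj]
    have hw' : ∀ j, 0 ≤ Function.update (fun j => if j ∈ A then u j else v j) i (u i) j := by
      intro j
      by_cases hj : j = i
      · subst hj; simpa using (hv j).trans (hvu j)
      · rw [Function.update_of_ne hj]; exact hw j
    rw [hup]
    by_cases hi : i ∈ S'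
    · rcases ((hv i).trans (hvu i)).eq_or_lt with h0 | h0
      · refine ⟨S', hS', hle.trans_eq ?_⟩
        congr 1
        refine profitCDF_congr r fun j _ => ?_
        by_cases hj : j = i
        · subst hj
          have := hv j
          have := hvu j
          simp only [hiA, if_false, Function.update_self]
          linarith
        · rw [Function.update_of_ne hj]
      · obtain ⟨a, ha0, ha1, hmix⟩ := profitCDF_update_eq_mixture r hw hi h0
          (by simpa [hiA] using hvu i)
        have hq := hU _ (profitCDF_mem_cdfUnit hr hw' S') _
          (profitCDF_mem_cdfUnit hr hw' (S'.erase i)) a ha0 ha1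
        rw [← hmix] at hq
        rcases le_max_iff.1 (hle.trans hq) with h | h
        · exact ⟨S', hS', h⟩
        · exact ⟨S'.erase i, (Finset.erase_subset _ _).trans hS', h⟩
    · refine ⟨S', hS', hle.trans_eq ?_⟩
      congr 1
      refine profitCDF_congr r fun j hj => ?_
      rw [Function.update_of_ne]
      rintro rfl
      exact hi hj

theorem optValue_le_of_le {N K : ℕ} {U : (ℝ → ℝ) → ℝ} (hU : RiskQuasiconvex U)
    {r : Fin N → ℝ} (hr : ∀ i, 0 ≤ r i ∧ r i ≤ 1) {v u : Fin N → ℝ} (hv : ∀ i, 0 ≤ v i)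
    (hvu : ∀ i, v i ≤ u i) {b : ℝ} (hb : ∀ S ∈ assortments N K, U (profitCDF r u S) ≤ b) :
    optValue U r v K ≤ b := by
  refine Finset.sup'_le _ _ fun S hS => ?_
  obtain ⟨S', hS', hle⟩ := exists_subset_le_of_le hU hr hv hvu Finset.univ S
  simp only [Finset.mem_univ, if_true] at hle
  refine hle.trans (hb S' ?_)
  simp only [assortments, Finset.mem_filter, Finset.mem_univ, true_and] at hS ⊢
  exact (Finset.card_le_card hS').trans hS

theorem sum_policy_mul {N : ℕ} (v : Fin N → ℝ) (σ : SelectionRule N) (h : History N)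
    (f : History N → ℝ) :
    ∑ x, choiceProb v (riskAwareUCB σ h) x * f (x :: h)
      = (f (none :: h) + ∑ i ∈ (ucbState σ h).offer, v i * f (some i :: h))
        / (1 + ∑ j ∈ (ucbState σ h).offer, v j) :=
  sum_choiceProb_mul v _ fun x => f (x :: h)

theorem ucbState_served_lt_episode {N : ℕ} (σ : SelectionRule N) (i : Fin N) :
    ∀ h : History N, (ucbState σ h).served i < (ucbState σ h).episode := by
  intro h
  induction h with
  | nil => simp [ucbState, startEpisode]
  | cons x h ih =>
    cases x with
    | none => simp only [ucbState, startEpisode]; split_ifs <;> omega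
    | some j => exact ih

theorem ucbState_episode_le {N : ℕ} (σ : SelectionRule N) :
    ∀ h : History N, (ucbState σ h).episode ≤ h.length + 1 := by
  intro h
  induction h with
  | nil => simp [ucbState, startEpisode]
  | cons x h ih =>
    cases x with
    | none => simp only [ucbState, startEpisode, List.length_cons]; omega
    | some j => simp only [ucbState, List.length_cons]; omega

/-- The optimistic estimates of the current episode. -/
noncomputable def currentEstimate {N : ℕ} (σ : SelectionRule N) (h : History N) : Fin N → ℝ :=
  fun i => optimisticEstimate N (ucbState σ h).episode ((ucbState σ h).served i)
    ((ucbState σ h).sold i)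

theorem ucbState_offer_eq {N : ℕ} (σ : SelectionRule N) :
    ∀ h : History N, ∃ h₀, (ucbState σ h).offer = σ h₀ (currentEstimate σ h) := by
  intro h
  induction h with
  | nil => exact ⟨[], rfl⟩
  | cons x h ih =>
    cases x with
    | none => exact ⟨none :: h, rfl⟩
    | some j => exact ih

/-- The number of purchases of `i` in all episodes in which it was served, the current one
included. -/
noncomputable def salesTotal {N : ℕ} (σ : SelectionRule N) (i : Fin N) (h : History N) : ℕ :=
  (ucbState σ h).sold i + if i ∈ (ucbState σ h).offer then (ucbState σ h).sales i else 0

/-- The exponential martingale of the purchases of `i`. -/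
noncomputable def expMartingale {N : ℕ} (v : Fin N → ℝ) (σ : SelectionRule N) (i : Fin N)
    (θ : ℝ) (h : History N) : ℝ :=
  Real.exp (θ * salesTotal σ i h)
    * (1 - v i * (Real.exp θ - 1)) ^ (ucbState σ h).served i

theorem salesTotal_none {N : ℕ} (σ : SelectionRule N) (i : Fin N) (h : History N) :
    salesTotal σ i (none :: h) = salesTotal σ i h := by
  have h1 : (ucbState σ (none :: h)).sales i = 0 := rfl
  rw [salesTotal, h1, ite_self, add_zero, salesTotal]
  simp only [ucbState, startEpisode]
  split_ifs <;> rfl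

theorem sold_none {N : ℕ} (σ : SelectionRule N) (i : Fin N) (h : History N) :
    (ucbState σ (none :: h)).sold i = salesTotal σ i (none :: h) := by
  have h1 : (ucbState σ (none :: h)).sales i = 0 := rfl
  rw [salesTotal, h1, ite_self, add_zero]

theorem expMartingale_none {N : ℕ} (v : Fin N → ℝ) (σ : SelectionRule N) (i : Fin N)
    (θ : ℝ) (h : History N) :
    expMartingale v σ i θ (none :: h) = expMartingale v σ i θ h
      * if i ∈ (ucbState σ h).offer then 1 - v i * (Real.exp θ - 1) else 1 := by
  rw [expMartingale, expMartingale, salesTotal_none]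
  simp only [ucbState, startEpisode]
  split_ifs <;> ring

theorem expMartingale_some {N : ℕ} (v : Fin N → ℝ) (σ : SelectionRule N) (i j : Fin N)
    (θ : ℝ) (h : History N) (hj : j ∈ (ucbState σ h).offer) :
    expMartingale v σ i θ (some j :: h) = expMartingale v σ i θ h
      * (1 + if j = i then Real.exp θ - 1 else 0) := by
  simp only [expMartingale, salesTotal, ucbState]
  by_cases hji : j = i
  · subst hji
    simp only [hj, if_true]
    push_cast
    rw [show θ * (((ucbState σ h).sold j : ℝ) + ((ucbState σ h).sales j + 1))
      = θ * ((ucbState σ h).sold j + (ucbState σ h).sales j) + θ by ring, Real.exp_add]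
    ring
  · simp [hji, Ne.symm hji]

theorem expMartingale_step {N : ℕ} {v : Fin N → ℝ} (hv : ∀ i, 0 ≤ v i) (σ : SelectionRule N)
    (i : Fin N) (θ : ℝ) (h : History N) :
    ∑ x, choiceProb v (riskAwareUCB σ h) x * expMartingale v σ i θ (x :: h)
      = expMartingale v σ i θ h := by
  rw [sum_policy_mul, div_eq_iff (one_add_sum_pos hv _).ne', expMartingale_none,
    Finset.sum_congr rfl fun j hj => by rw [expMartingale_some v σ i j θ h hj]]
  have : ∀ j, v j * (expMartingale v σ i θ h * (1 + if j = i then Real.exp θ - 1 else 0))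
      = expMartingale v σ i θ h * v j
        + if j = i then expMartingale v σ i θ h * (v i * (Real.exp θ - 1)) else 0 := by
    intro j
    by_cases hji : j = i
    · subst hji; simp; ring
    · simp [hji]; ring
  simp only [this, Finset.sum_add_distrib, Finset.sum_ite_eq', ← Finset.mul_sum]
  split_ifs <;> ring

/-- Bound for the expected number of completed episodes numbered `ℓ`, before which `i` was
served `n` times and its sales satisfy `B`. -/
theorem expectedTotal_episode_le {N : ℕ} {v : Fin N → ℝ} (hv : ∀ i, 0 ≤ v i)
    (σ : SelectionRule N) (i : Fin N) {ℓ n : ℕ} (hℓ : 2 ≤ ℓ) (B : ℕ → Prop) [DecidablePred B]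
    {θ b : ℝ} (hb : 0 < b) (hρ : 0 ≤ 1 - v i * (Real.exp θ - 1))
    (hB : ∀ m, B m → b ≤ Real.exp (θ * m) * (1 - v i * (Real.exp θ - 1)) ^ n) (T : ℕ) :
    expectedTotal v (riskAwareUCB σ) (fun h =>
      (if (ucbState σ h).episode = ℓ ∧ (ucbState σ h).served i = n ∧ B ((ucbState σ h).sold i)
        then 1 else 0) / (1 + ∑ j ∈ (ucbState σ h).offer, v j)) T [] ≤ 1 / b := by
  set Φ : History N → ℝ := fun h =>
    if (ucbState σ h).episode < ℓ then expMartingale v σ i θ h / b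
    else if (ucbState σ h).episode = ℓ ∧ (ucbState σ h).served i = n
      ∧ B ((ucbState σ h).sold i) then 1 else 0 with hΦ
  have hM : ∀ h, 0 ≤ expMartingale v σ i θ h := fun h =>
    mul_nonneg (Real.exp_nonneg _) (pow_nonneg hρ _)
  have h0 : ∀ h, 0 ≤ Φ h := fun h => by
    have := div_nonneg (hM h) hb.le
    simp only [hΦ]
    split_ifs <;> simp [this]
  refine (expectedTotal_le_of_potential hv (riskAwareUCB σ) _ (fun _ => Φ) T
    (fun h _ => h0 h) (fun m h _ => ?_) T [] (by simp)).trans_eq ?_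
  rotate_left
  · have h1 : (1 : ℕ) < ℓ := by omega
    have hi : expMartingale v σ i θ [] = 1 := by
      have h2 : (ucbState σ ([] : History N)).sales i = 0 := rfl
      have h3 : (ucbState σ ([] : History N)).sold i = 0 := rfl
      have h4 : (ucbState σ ([] : History N)).served i = 0 := rfl
      rw [expMartingale, salesTotal, h2, h3, h4, ite_self]
      simp
    have he : (ucbState σ ([] : History N)).episode = 1 := rfl
    simp only [hΦ, he, h1, if_true, hi]
  · have hD := one_add_sum_pos hv (ucbState σ h).offer
    by_cases hlt : (ucbState σ h).episode < ℓ
    · have hne : ¬ (ucbState σ h).episode = ℓ := hlt.ne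
      have hΦh : Φ h = expMartingale v σ i θ h / b := by simp only [hΦ, hlt, if_true]
      have hle : ∀ x, Φ (x :: h) ≤ expMartingale v σ i θ (x :: h) / b := by
        intro x
        by_cases hx : (ucbState σ (x :: h)).episode < ℓ
        · simp only [hΦ, hx, if_true, le_refl]
        · have hx0 := div_nonneg (hM (x :: h)) hb.le
          cases x with
          | some j => exact absurd hlt hx
          | none =>
            by_cases hE : (ucbState σ (none :: h)).episode = ℓ
              ∧ (ucbState σ (none :: h)).served i = n ∧ B ((ucbState σ (none :: h)).sold i)
            · simp only [hΦ]
              rw [if_neg hx, if_pos hE, one_le_div hb, expMartingale, hE.2.1, ← sold_none]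
              exact hB _ hE.2.2
            · simpa only [hΦ, hx, hE, if_false] using hx0
      rw [hΦh]
      simp only [hne, false_and, if_false, zero_div, zero_add]
      calc ∑ x, choiceProb v (riskAwareUCB σ h) x * Φ (x :: h)
          ≤ ∑ x, choiceProb v (riskAwareUCB σ h) x * (expMartingale v σ i θ (x :: h) / b) := by
            gcongr with x
            · exact choiceProb_nonneg hv _ _
            · exact hle x
        _ = expMartingale v σ i θ h / b := by
            rw [← expMartingale_step hv σ i θ h, Finset.sum_div]
            exact Finset.sum_congr rfl fun x _ => by ring
    · have hnone : Φ (none :: h) = 0 := by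
        have h1 : ¬ (ucbState σ h).episode + 1 < ℓ := by omega
        have h2 : ¬ (ucbState σ h).episode + 1 = ℓ := by omega
        simp only [hΦ, ucbState, startEpisode, h1, h2, if_false, false_and]
      have hsome : ∀ j, Φ (some j :: h) = Φ h := fun j => by
        simp only [hΦ, ucbState, hlt, if_false]
        rfl
      have hΦh : (if (ucbState σ h).episode = ℓ ∧ (ucbState σ h).served i = n
          ∧ B ((ucbState σ h).sold i) then (1 : ℝ) else 0) = Φ h := by
        simp only [hΦ, hlt, if_false]
      rw [sum_policy_mul, hΦh, hnone]
      simp only [hsome, ← Finset.sum_mul]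
      rw [← add_div, div_le_iff₀ hD]
      linarith

theorem sum_episode_tail_le {N : ℕ} (hN : 1 ≤ N) (T : ℕ) :
    ∑ ℓ ∈ Finset.Icc 2 T, ∑ _n ∈ Finset.Ico 1 ℓ, 1 / (√(N : ℝ) * ℓ + 1) ^ 3
      ≤ 1 / (2 * (N : ℝ)) := by
  have hN0 : (1 : ℝ) ≤ N := by exact_mod_cast hN
  have hs : (1 : ℝ) ≤ √(N : ℝ) := Real.one_le_sqrt.2 hN0
  have hss : √(N : ℝ) ^ 2 = N := Real.sq_sqrt (by positivity)
  have h_term : ∀ ℓ : ℕ, 2 ≤ ℓ → ∑ _n ∈ Finset.Ico 1 ℓ, 1 / (√(N : ℝ) * ℓ + 1) ^ 3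
      ≤ 1 / N * (1 / (ℓ : ℝ) - 1 / (ℓ + 1)) := by
    intro ℓ hℓ
    have hℓ' : (2 : ℝ) ≤ ℓ := by exact_mod_cast hℓ
    rw [Finset.sum_const, Nat.card_Ico, nsmul_eq_mul, Nat.cast_sub (by omega), Nat.cast_one]
    have h1 : (1 : ℝ) / N * (1 / (ℓ : ℝ) - 1 / (ℓ + 1)) = ℓ / (N * ℓ ^ 2 * (ℓ + 1)) := by
      have : (N : ℝ) ≠ 0 := by positivity
      have : (ℓ : ℝ) ≠ 0 := by positivity
      field_simp
      ring
    have h2 : (N : ℝ) * ℓ ^ 2 ≤ (√(N : ℝ) * ℓ + 1) ^ 2 := by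
      nlinarith [mul_nonneg (Real.sqrt_nonneg (N : ℝ)) (Nat.cast_nonneg (α := ℝ) ℓ)]
    have h3 : (ℓ : ℝ) + 1 ≤ √(N : ℝ) * ℓ + 1 := by nlinarith
    have h4 : (N : ℝ) * ℓ ^ 2 * (ℓ + 1) ≤ (√(N : ℝ) * ℓ + 1) ^ 3 := by
      rw [pow_succ (√(N : ℝ) * ℓ + 1) 2]
      gcongr
    rw [h1, mul_one_div]
    gcongr
    linarith
  refine (Finset.sum_le_sum fun ℓ hℓ => h_term ℓ (Finset.mem_Icc.1 hℓ).1).trans ?_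
  rw [← Finset.mul_sum, show 1 / (2 * (N : ℝ)) = 1 / N * (1 / 2) by field_simp]
  gcongr
  have h_tel : ∀ M : ℕ, ∑ ℓ ∈ Finset.Icc 2 (M + 1), (1 / (ℓ : ℝ) - 1 / (ℓ + 1))
      = 1 / 2 - 1 / ((M : ℝ) + 2) := by
    intro M
    induction M with
    | zero => simp
    | succ M ih =>
      rw [Finset.sum_Icc_succ_top (by omega), ih]
      push_cast
      ring
  rcases T with _ | M
  · simp
  · rw [h_tel]
    have : 0 ≤ 1 / ((M : ℝ) + 2) := by positivity
    linarith

/-- Bound for the expected number of completed episodes before which `i` was served at least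
once and in which a condition with exponentially small probability holds. -/
theorem expectedTotal_tail_le {N : ℕ} (hN : 1 ≤ N) {v : Fin N → ℝ} (hv : ∀ i, 0 ≤ v i)
    (σ : SelectionRule N) (i : Fin N) (B : ℕ → ℕ → ℕ → Prop) [∀ ℓ n, DecidablePred (B ℓ n)]
    (hB : ∀ ℓ n, 2 ≤ ℓ → 1 ≤ n → ∃ θ : ℝ, 0 ≤ 1 - v i * (Real.exp θ - 1) ∧
      ∀ m, B ℓ n m →
        (√(N : ℝ) * ℓ + 1) ^ 3 ≤ Real.exp (θ * m) * (1 - v i * (Real.exp θ - 1)) ^ n)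
    (T : ℕ) :
    expectedTotal v (riskAwareUCB σ) (fun h =>
      (if 1 ≤ (ucbState σ h).served i ∧
          B (ucbState σ h).episode ((ucbState σ h).served i) ((ucbState σ h).sold i)
        then 1 else 0) / (1 + ∑ j ∈ (ucbState σ h).offer, v j)) T [] ≤ 1 / (2 * (N : ℝ)) := by
  refine le_trans (expectedTotal_mono hv _ (c' := fun h => ∑ ℓ ∈ Finset.Icc 2 T,
    ∑ n ∈ Finset.Ico 1 ℓ, (if (ucbState σ h).episode = ℓ ∧ (ucbState σ h).served i = n
      ∧ B ℓ n ((ucbState σ h).sold i) then 1 else 0)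
        / (1 + ∑ j ∈ (ucbState σ h).offer, v j)) fun h hT => ?_) ?_
  · have hD := one_add_sum_pos hv (ucbState σ h).offer
    have h_nonneg : ∀ ℓ n, (0 : ℝ) ≤ (if (ucbState σ h).episode = ℓ
        ∧ (ucbState σ h).served i = n ∧ B ℓ n ((ucbState σ h).sold i) then 1 else 0)
        / (1 + ∑ j ∈ (ucbState σ h).offer, v j) := by
      intro ℓ n
      split_ifs <;> positivity
    by_cases hc : 1 ≤ (ucbState σ h).served i ∧
      B (ucbState σ h).episode ((ucbState σ h).served i) ((ucbState σ h).sold i)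
    · have h1 := ucbState_served_lt_episode σ i h
      have h2 := ucbState_episode_le σ h
      refine le_trans ?_ (Finset.single_le_sum (fun ℓ _ => Finset.sum_nonneg fun n _ =>
        h_nonneg ℓ n) (Finset.mem_Icc.2 ⟨by omega, by omega⟩ :
          (ucbState σ h).episode ∈ Finset.Icc 2 T))
      refine le_trans ?_ (Finset.single_le_sum (fun n _ => h_nonneg _ n)
        (Finset.mem_Ico.2 ⟨hc.1, h1⟩))
      simp [hc]
    · rw [if_neg hc, zero_div]
      exact Finset.sum_nonneg fun ℓ _ => Finset.sum_nonneg fun n _ => h_nonneg ℓ n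
  · rw [expectedTotal_sum]
    refine le_trans (Finset.sum_le_sum fun ℓ hℓ => ?_) (sum_episode_tail_le hN T)
    rw [expectedTotal_sum]
    refine Finset.sum_le_sum fun n hn => ?_
    obtain ⟨θ, hρ, hθ⟩ := hB ℓ n (Finset.mem_Icc.1 hℓ).1 (Finset.mem_Ico.1 hn).1
    exact expectedTotal_episode_le hv σ i (Finset.mem_Icc.1 hℓ).1 _ (by positivity) hρ hθ T

theorem le_exp_mul_pow {b θ y : ℝ} {m n : ℕ} (hy : 0 < 1 + y)
    (h : b ≤ θ * m + n * (y / (1 + y))) :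
    Real.exp b ≤ Real.exp (θ * m) * (1 + y) ^ n := by
  have h1 : y / (1 + y) ≤ Real.log (1 + y) := by
    have := Real.one_sub_inv_le_log_of_pos hy
    have h2 : y / (1 + y) = 1 - (1 + y)⁻¹ := by field_simp; ring
    linarith
  have h3 : (1 + y) ^ n = Real.exp (n * Real.log (1 + y)) := by
    rw [Real.exp_nat_mul, Real.exp_log hy]
  rw [h3, ← Real.exp_add]
  refine Real.exp_le_exp.2 (h.trans ?_)
  gcongr

/-- Chernoff bound for the event that a preference parameter exceeds its optimistic estimate. -/
theorem exists_exp_lower_tail {v L : ℝ} (hv : 0 ≤ v) (hv1 : v ≤ 1) (hL : 0 ≤ L) {n : ℕ}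
    (hn : 1 ≤ n) :
    ∃ θ : ℝ, 0 ≤ 1 - v * (Real.exp θ - 1) ∧ ∀ m : ℕ,
      (m : ℝ) / n + √((m : ℝ) / n * (L / n)) + L / n < v →
        Real.exp (L / 16) ≤ Real.exp (θ * m) * (1 - v * (Real.exp θ - 1)) ^ n := by
  have hn0 : (0 : ℝ) < n := by exact_mod_cast hn
  rcases hv.eq_or_lt with rfl | hv0
  · refine ⟨0, by simp, fun m hm => absurd hm (not_lt.2 ?_)⟩
    positivity
  set d₀ : ℝ := √(L * v / (2 * n)) with hd₀
  have hd₀n : 0 ≤ d₀ := Real.sqrt_nonneg _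
  have hd₀sq : d₀ ^ 2 = L * v / (2 * n) := Real.sq_sqrt (by positivity)
  set s : ℝ := d₀ / (4 * v) with hs
  have hs0 : 0 ≤ s := by positivity
  set E : ℝ := Real.exp (-s) with hE
  have hE1 : 1 - s ≤ E := by
    have := Real.add_one_le_exp (-s)
    linarith
  have hE2 : E * (1 + s) ≤ 1 := by
    have h1 := Real.add_one_le_exp s
    have h2 : E * Real.exp s = 1 := by rw [hE, ← Real.exp_add]; simp
    have h3 : 0 ≤ E := Real.exp_nonneg _
    nlinarith
  have hE3 : E ≤ 1 := Real.exp_le_one_iff.2 (by linarith)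
  have hE4 : s - s ^ 2 ≤ 1 - E := by
    by_contra hcon
    have h1 : (1 - E) * (1 + s) < (s - s ^ 2) * (1 + s) := by
      apply mul_lt_mul_of_pos_right (not_le.1 hcon); linarith
    nlinarith [pow_nonneg hs0 3]
  set y : ℝ := v * (1 - E) with hy
  have hy0 : 0 ≤ y := mul_nonneg hv (by linarith)
  have hys : y ≤ v * s := mul_le_mul_of_nonneg_left (by linarith) hv
  have hρ : 1 - v * (E - 1) = 1 + y := by rw [hy]; ring
  refine ⟨-s, by rw [← hE, hρ]; linarith, fun m hm => ?_⟩
  rw [← hE, hρ]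
  refine le_exp_mul_pow (by linarith) ?_
  have hfrac : v * s - 2 * v * s ^ 2 ≤ y / (1 + y) := by
    have h1 : y - y ^ 2 ≤ y / (1 + y) := by
      rw [le_div_iff₀ (by linarith)]
      nlinarith [pow_nonneg hy0 3]
    have h2 : y ^ 2 ≤ v * s ^ 2 := by
      calc y ^ 2 ≤ (v * s) ^ 2 := by gcongr
        _ = v * (v * s ^ 2) := by ring
        _ ≤ 1 * (v * s ^ 2) := by gcongr
        _ = v * s ^ 2 := one_mul _
    have h3 : v * (s - s ^ 2) ≤ y := mul_le_mul_of_nonneg_left hE4 hv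
    nlinarith
  have hd : d₀ ≤ v - m / n := by
    have hpq : 0 ≤ (m : ℝ) / n * (L / n) := by positivity
    have ha := Real.sqrt_nonneg ((m : ℝ) / n * (L / n))
    have ha2 := Real.sq_sqrt hpq
    have hq : 0 ≤ L / n := by positivity
    set a := √((m : ℝ) / n * (L / n))
    set p := (m : ℝ) / n
    set q := L / n
    have hdpos : a + q ≤ v - p := by linarith
    apply Real.sqrt_le_iff.2 ⟨by linarith, ?_⟩
    have h1 : L * v / (2 * n) = q * v / 2 := by simp only [q]; field_simp
    rw [h1]
    have h2 : a ^ 2 ≤ (v - p) ^ 2 := by gcongr; linarith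
    have h3 : q * (v - p) ≤ (v - p) ^ 2 := by
      rw [pow_two]; gcongr <;> linarith
    nlinarith
  have h5 : L / 16 = n * (s * d₀ - 2 * v * s ^ 2) := by
    have h6 : n * (s * d₀ - 2 * v * s ^ 2) = n * d₀ ^ 2 / (8 * v) := by
      rw [hs]; field_simp; ring
    rw [h6, hd₀sq]; field_simp; ring
  calc L / 16 = n * (s * d₀ - 2 * v * s ^ 2) := h5
    _ ≤ n * (s * (v - m / n) - 2 * v * s ^ 2) := by gcongr
    _ = -s * m + n * (v * s - 2 * v * s ^ 2) := by field_simp; ring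
    _ ≤ -s * m + n * (y / (1 + y)) := by gcongr

/-- Chernoff bound for the event that the average sales are much larger than a preference
parameter. -/
theorem exists_exp_upper_tail {v L : ℝ} (hv : 0 ≤ v) (hv1 : v ≤ 1) (hL : 0 ≤ L) {n : ℕ}
    (hn : 1 ≤ n) :
    ∃ θ : ℝ, 0 ≤ 1 - v * (Real.exp θ - 1) ∧ ∀ m : ℕ,
      v + 2 * (√(v * (L / n)) + L / n) < (m : ℝ) / n →
        Real.exp (L / 16) ≤ Real.exp (θ * m) * (1 - v * (Real.exp θ - 1)) ^ n := by
  have hn0 : (0 : ℝ) < n := by exact_mod_cast hn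
  have hq : 0 ≤ L / n := by positivity
  have hLq : L = n * (L / n) := by field_simp
  set q := L / n
  obtain ⟨s, hs0, hs1, hsd⟩ : ∃ s : ℝ, 0 ≤ s ∧ s ≤ 1 / 4 ∧
      3 * q / 16 ≤ s * (2 * (√(v * q) + q)) - 5 * v * s ^ 2 := by
    by_cases hc : 0 < v ∧ q ≤ v
    · obtain ⟨hv0, hqv⟩ := hc
      refine ⟨√(q / v) / 4, by positivity, ?_, ?_⟩
      · have : √(q / v) ≤ 1 := Real.sqrt_le_one.2 ((div_le_one hv0).2 hqv)
        linarith
      · have h1 : √(q / v) * √(v * q) = q := by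
          rw [← Real.sqrt_mul (by positivity), show q / v * (v * q) = q ^ 2 by field_simp,
            Real.sqrt_sq hq]
        have h2 : v * √(q / v) ^ 2 = q := by
          rw [Real.sq_sqrt (by positivity)]; field_simp
        have h3 : 0 ≤ √(q / v) * q := by positivity
        nlinarith
    · have hqv : v ≤ q := by
        rcases hv.eq_or_lt with rfl | hv0
        · exact hq
        · by_contra h; exact hc ⟨hv0, (not_le.1 h).le⟩
      refine ⟨1 / 4, by norm_num, le_rfl, ?_⟩
      have := Real.sqrt_nonneg (v * q)
      linarith
  have hexp : Real.exp s - 1 ≤ s + s ^ 2 := by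
    have := (abs_le.1 (Real.abs_exp_sub_one_sub_id_le
      (abs_le.2 ⟨by linarith, by linarith⟩ : |s| ≤ 1))).2
    linarith
  have hexp0 : 0 ≤ Real.exp s - 1 := by linarith [Real.add_one_le_exp s]
  set z : ℝ := v * (Real.exp s - 1) with hz
  have hz0 : 0 ≤ z := mul_nonneg hv hexp0
  have hz1 : z ≤ v * (s + s ^ 2) := mul_le_mul_of_nonneg_left hexp hv
  have hz2 : z ≤ v * (5 / 4 * s) := hz1.trans (by gcongr; nlinarith)
  have hz3 : z ≤ 1 / 2 := by nlinarith
  refine ⟨s, by linarith, fun m hm => ?_⟩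
  rw [sub_eq_add_neg]
  refine le_exp_mul_pow (by linarith) ?_
  have hfrac : -(v * s + 5 * v * s ^ 2) ≤ -z / (1 + -z) := by
    have h1 : -(z + 2 * z ^ 2) ≤ -z / (1 + -z) := by
      rw [le_div_iff₀ (by linarith)]
      nlinarith [mul_nonneg (sq_nonneg z) (by linarith : 0 ≤ 1 - 2 * z)]
    have h2 : z ^ 2 ≤ 25 / 16 * (v * s ^ 2) := by
      calc z ^ 2 ≤ (v * (5 / 4 * s)) ^ 2 := by gcongr
        _ = v * (25 / 16 * (v * s ^ 2)) := by ring
        _ ≤ 1 * (25 / 16 * (v * s ^ 2)) := by gcongr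
        _ = _ := one_mul _
    have h3 : 0 ≤ v * s ^ 2 := by positivity
    nlinarith
  calc L / 16 ≤ n * (3 * q / 16) := by rw [hLq]; nlinarith [mul_nonneg hn0.le hq]
    _ ≤ n * (s * (2 * (√(v * q) + q)) - 5 * v * s ^ 2) := by gcongr
    _ ≤ n * (s * (m / n - v) - 5 * v * s ^ 2) := by gcongr; linarith
    _ = s * m + n * -(v * s + 5 * v * s ^ 2) := by field_simp; ring
    _ ≤ s * m + n * (-z / (1 + -z)) := by gcongr

theorem optimisticEstimate_le_one (N ℓ n m : ℕ) : optimisticEstimate N ℓ n m ≤ 1 := by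
  rw [optimisticEstimate]
  split_ifs
  · exact le_rfl
  · exact min_le_right _ _

theorem optimisticEstimate_sub_le {v : ℝ} (hv : 0 ≤ v) {N ℓ n m : ℕ} (hn : n ≠ 0)
    (h : (m : ℝ) / n ≤ v + 2 * (√(v * (48 * Real.log (√(N : ℝ) * ℓ + 1) / n))
      + 48 * Real.log (√(N : ℝ) * ℓ + 1) / n)) :
    optimisticEstimate N ℓ n m - v
      ≤ 3 * √(v * (48 * Real.log (√(N : ℝ) * ℓ + 1) / n))
        + 5 * (48 * Real.log (√(N : ℝ) * ℓ + 1) / n) := by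
  have hq : 0 ≤ 48 * Real.log (√(N : ℝ) * ℓ + 1) / n := by
    have : 0 ≤ Real.log (√(N : ℝ) * ℓ + 1) := Real.log_nonneg (by
      have : 0 ≤ √(N : ℝ) * ℓ := by positivity
      linarith)
    positivity
  rw [optimisticEstimate, if_neg hn]
  refine (sub_le_sub_right (min_le_left _ _) v).trans ?_
  set q := 48 * Real.log (√(N : ℝ) * ℓ + 1) / n
  set p := (m : ℝ) / n
  have h1 : √(p * q) ≤ √(v * q) + 2 * q := by
    have h2 := Real.sq_sqrt (mul_nonneg hv hq)
    have h3 := Real.sqrt_nonneg (v * q)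
    refine Real.sqrt_le_iff.2 ⟨by positivity, ?_⟩
    nlinarith [mul_le_mul_of_nonneg_right h hq, mul_nonneg h3 hq, mul_nonneg hq hq]
  linarith

/-- Bound for a cost that is incurred once for each completed service of a product. -/
theorem expectedTotal_served_le {N : ℕ} {v : Fin N → ℝ} (hv : ∀ i, 0 ≤ v i)
    (σ : SelectionRule N) (g : Fin N → ℕ → ℝ) {T : ℕ} {A b : ℝ} (hb : 0 ≤ b)
    (hg : ∀ i, ∀ n ≤ T, ∑ k ∈ Finset.range n, g i k ≤ A + b * (v i * n)) :
    expectedTotal v (riskAwareUCB σ) (fun h =>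
      (∑ i ∈ (ucbState σ h).offer, g i ((ucbState σ h).served i))
        / (1 + ∑ j ∈ (ucbState σ h).offer, v j)) T [] ≤ N * A + b * T := by
  set G : History N → ℝ := fun h => ∑ i, (A + b * (v i * (ucbState σ h).served i)
    - ∑ k ∈ Finset.range ((ucbState σ h).served i), g i k) with hG
  refine (expectedTotal_le_of_potential hv (riskAwareUCB σ) _ (fun m h => G h + b * m) T
    (fun h hT => ?_) (fun m h _ => ?_) T [] (by simp)).trans_eq ?_
  · simp only [Nat.cast_zero, mul_zero, add_zero]
    refine Finset.sum_nonneg fun i _ => sub_nonneg.2 (hg i _ ?_)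
    have := ucbState_served_lt_episode σ i h
    have := ucbState_episode_le σ h
    omega
  · have hD := one_add_sum_pos hv (ucbState σ h).offer
    have hnone : G (none :: h) = G h + ∑ i ∈ (ucbState σ h).offer,
        (b * v i - g i ((ucbState σ h).served i)) := by
      rw [← Finset.sum_subset (Finset.subset_univ (ucbState σ h).offer)
          (f := fun i => if i ∈ (ucbState σ h).offer then
            b * v i - g i ((ucbState σ h).served i) else 0) (fun i _ hi => if_neg hi)
          |>.symm.trans (Finset.sum_congr rfl fun i hi => if_pos hi), hG]
      simp only [← Finset.sum_add_distrib]
      refine Finset.sum_congr rfl fun i _ => ?_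
      simp only [ucbState, startEpisode]
      split_ifs
      · rw [Finset.sum_range_succ]
        push_cast
        ring
      · ring
    have hsome : ∀ j, G (some j :: h) = G h := fun j => rfl
    have hP := sum_policy_mul v σ h fun h' => G h' + b * m
    beta_reduce at hP
    rw [hP, hnone]
    simp only [hsome, ← Finset.sum_mul, Finset.sum_sub_distrib, ← Finset.mul_sum]
    rw [← add_div, div_le_iff₀ hD]
    push_cast
    nlinarith
  · simp [hG, ucbState, startEpisode]

theorem sum_range_one_div_sqrt_le (n : ℕ) :
    ∑ k ∈ Finset.range n, 1 / √(k : ℝ) ≤ 2 * √(n : ℝ) := by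
  have h : ∀ n : ℕ, ∑ k ∈ Finset.range (n + 1), 1 / √(k : ℝ) ≤ 2 * √(n : ℝ) := by
    intro n
    induction n with
    | zero => simp
    | succ n ih =>
      rw [Finset.sum_range_succ]
      have hpos : 0 < √((n + 1 : ℕ) : ℝ) := Real.sqrt_pos.2 (by positivity)
      have h1 : √((n + 1 : ℕ) : ℝ) ^ 2 = n + 1 := by
        rw [Real.sq_sqrt (by positivity)]; push_cast; ring
      have h2 := Real.sq_sqrt (Nat.cast_nonneg (α := ℝ) n)
      have h3 : 1 / √((n + 1 : ℕ) : ℝ) ≤ 2 * √((n + 1 : ℕ) : ℝ) - 2 * √(n : ℝ) := by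
        rw [div_le_iff₀ hpos]
        nlinarith [sq_nonneg (√((n + 1 : ℕ) : ℝ) - √(n : ℝ))]
      linarith
  refine le_trans ?_ (h n)
  rw [Finset.sum_range_succ]
  have : 0 ≤ 1 / √(n : ℝ) := by positivity
  linarith

theorem sum_range_one_div_le {n T : ℕ} (hn : n ≤ T) :
    ∑ k ∈ Finset.range n, 1 / (k : ℝ) ≤ 1 + Real.log T := by
  have h1 := harmonic_le_one_add_log T
  have h2 : ((harmonic T : ℚ) : ℝ) = ∑ k ∈ Finset.range (T + 1), 1 / (k : ℝ) := by
    rw [harmonic, Finset.sum_range_succ']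
    push_cast
    simp
  rw [h2] at h1
  refine le_trans (Finset.sum_le_sum_of_subset_of_nonneg
    (Finset.range_subset_range.2 (by omega)) fun k _ _ => by positivity) h1

/-- Bound for the total width of the confidence intervals of the products served. -/
theorem expectedTotal_width_le {N T : ℕ} (hN : 1 ≤ N) (hT : 1 ≤ T) {v : Fin N → ℝ}
    (hv : ∀ i, 0 ≤ v i) (σ : SelectionRule N) {L : ℝ} (hL : 0 ≤ L) :
    expectedTotal v (riskAwareUCB σ) (fun h =>
      (∑ i ∈ (ucbState σ h).offer, ((if (ucbState σ h).served i = 0 then 1 else 0)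
          + 3 * √(v i * (L / (ucbState σ h).served i)) + 5 * (L / (ucbState σ h).served i)))
        / (1 + ∑ j ∈ (ucbState σ h).offer, v j)) T []
      ≤ N + 6 * √L * √((N : ℝ) * T) + 5 * L * N * (1 + Real.log T) := by
  have hN0 : (0 : ℝ) < N := by exact_mod_cast hN
  have hT0 : (0 : ℝ) < T := by exact_mod_cast hT
  have hsN : 0 < √(N : ℝ) := Real.sqrt_pos.2 hN0
  have hsT : 0 < √(T : ℝ) := Real.sqrt_pos.2 hT0
  have hsN2 := Real.sq_sqrt hN0.le
  have hsT2 := Real.sq_sqrt hT0.le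
  refine (expectedTotal_served_le hv σ (fun i n => (if n = 0 then 1 else 0)
    + 3 * √(v i * (L / n)) + 5 * (L / n))
    (A := 1 + 3 * √L * (√(T : ℝ) / √(N : ℝ)) + 5 * L * (1 + Real.log T))
    (b := 3 * √L * (√(N : ℝ) / √(T : ℝ))) (by positivity) fun i n hn => ?_).trans_eq ?_
  · have h1 : ∑ k ∈ Finset.range n, (if k = 0 then (1 : ℝ) else 0) ≤ 1 := by
      rw [Finset.sum_ite_eq']
      split_ifs <;> norm_num
    have h2 : ∑ k ∈ Finset.range n, 3 * √(v i * (L / k)) ≤ 6 * √L * √(v i * n) := by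
      have : ∀ k : ℕ, 3 * √(v i * (L / k)) = 3 * √L * √(v i) * (1 / √(k : ℝ)) := fun k => by
        rw [Real.sqrt_mul (hv i), Real.sqrt_div hL]; ring
      rw [Finset.sum_congr rfl fun k _ => this k, ← Finset.mul_sum, Real.sqrt_mul (hv i)]
      have h3 := mul_le_mul_of_nonneg_left (sum_range_one_div_sqrt_le n)
        (by positivity : 0 ≤ 3 * √L * √(v i))
      linarith
    have h4 : 2 * √(v i * n) ≤ √(T : ℝ) / √(N : ℝ) + √(N : ℝ) / √(T : ℝ) * (v i * n) := by
      have h5 := Real.sq_sqrt (mul_nonneg (hv i) (Nat.cast_nonneg n))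
      set x := √(v i * n)
      rw [← h5]
      have h6 : √(T : ℝ) / √(N : ℝ) + √(N : ℝ) / √(T : ℝ) * x ^ 2 - 2 * x
        = (√(T : ℝ) - √(N : ℝ) * x) ^ 2 / (√(N : ℝ) * √(T : ℝ)) := by
        field_simp
        ring
      have h7 : 0 ≤ (√(T : ℝ) - √(N : ℝ) * x) ^ 2 / (√(N : ℝ) * √(T : ℝ)) := by positivity
      linarith
    have h8 : ∑ k ∈ Finset.range n, 5 * (L / (k : ℝ)) ≤ 5 * L * (1 + Real.log T) := by
      have : ∀ k : ℕ, 5 * (L / (k : ℝ)) = 5 * L * (1 / k) := fun k => by ring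
      rw [Finset.sum_congr rfl fun k _ => this k, ← Finset.mul_sum]
      gcongr
      exact sum_range_one_div_le hn
    have h9 := mul_le_mul_of_nonneg_left h4 (by positivity : 0 ≤ 3 * √L)
    rw [Finset.sum_add_distrib, Finset.sum_add_distrib]
    linarith
  · rw [Real.sqrt_mul hN0.le]
    have h1 : (N : ℝ) * (√(T : ℝ) / √(N : ℝ)) = √(N : ℝ) * √(T : ℝ) := by
      nth_rewrite 1 [← hsN2]; field_simp
    have h2 : √(N : ℝ) / √(T : ℝ) * T = √(N : ℝ) * √(T : ℝ) := by
      nth_rewrite 2 [← hsT2]; field_simp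
    linear_combination 3 * √L * h1 + 3 * √L * h2

/-- The logarithmic factor of the confidence intervals. -/
noncomputable def logFactor (N ℓ : ℕ) : ℝ := 48 * Real.log (√(N : ℝ) * ℓ + 1)

theorem logFactor_nonneg (N ℓ : ℕ) : 0 ≤ logFactor N ℓ := by
  have : 0 ≤ Real.log (√(N : ℝ) * ℓ + 1) := Real.log_nonneg (by
    have : 0 ≤ √(N : ℝ) * ℓ := by positivity
    linarith)
  rw [logFactor]
  positivity

theorem logFactor_mono (N : ℕ) {ℓ T : ℕ} (h : ℓ ≤ T) : logFactor N ℓ ≤ logFactor N T := by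
  rw [logFactor, logFactor]
  gcongr

theorem pow_three_eq_exp_logFactor (N ℓ : ℕ) :
    (√(N : ℝ) * ℓ + 1) ^ 3 = Real.exp (logFactor N ℓ / 16) := by
  rw [logFactor, show 48 * Real.log (√(N : ℝ) * ℓ + 1) / 16
    = (3 : ℕ) * Real.log (√(N : ℝ) * ℓ + 1) by push_cast; ring, Real.exp_nat_mul,
    Real.exp_log (by positivity)]

/-- The preference parameter `x` exceeds its untruncated optimistic estimate. -/
def Underestimated (x : ℝ) (N ℓ n m : ℕ) : Prop :=
  (m : ℝ) / n + √((m : ℝ) / n * (logFactor N ℓ / n)) + logFactor N ℓ / n < x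

/-- The average sales exceed the preference parameter `x` by more than the confidence width. -/
def Oversold (x : ℝ) (N ℓ n m : ℕ) : Prop :=
  x + 2 * (√(x * (logFactor N ℓ / n)) + logFactor N ℓ / n) < (m : ℝ) / n

noncomputable instance (x : ℝ) (N ℓ n : ℕ) : DecidablePred (Underestimated x N ℓ n) :=
  fun _ => Classical.propDecidable _

noncomputable instance (x : ℝ) (N ℓ n : ℕ) : DecidablePred (Oversold x N ℓ n) :=
  fun _ => Classical.propDecidable _

theorem le_currentEstimate {N : ℕ} {v : Fin N → ℝ} (hv1 : ∀ i, v i ≤ 1) (σ : SelectionRule N)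
    (h : History N) (i : Fin N)
    (hgood : ¬ (1 ≤ (ucbState σ h).served i ∧ Underestimated (v i) N (ucbState σ h).episode
      ((ucbState σ h).served i) ((ucbState σ h).sold i))) :
    v i ≤ currentEstimate σ h i := by
  rw [currentEstimate, optimisticEstimate]
  split_ifs with h0
  · exact hv1 i
  · refine le_min (not_lt.1 fun hlt => hgood ⟨by omega, ?_⟩) (hv1 i)
    exact hlt

theorem currentEstimate_sub_le {N T : ℕ} {v : Fin N → ℝ} (hv : ∀ i, 0 ≤ v i)
    (σ : SelectionRule N) {h : History N} (hT : h.length < T) (i : Fin N) :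
    currentEstimate σ h i - v i
      ≤ ((if (ucbState σ h).served i = 0 then 1 else 0)
          + 3 * √(v i * (logFactor N T / (ucbState σ h).served i))
          + 5 * (logFactor N T / (ucbState σ h).served i))
        + if 1 ≤ (ucbState σ h).served i ∧ Oversold (v i) N (ucbState σ h).episode
            ((ucbState σ h).served i) ((ucbState σ h).sold i) then 1 else 0 := by
  have hle1 : currentEstimate σ h i - v i ≤ 1 := by
    have := optimisticEstimate_le_one N (ucbState σ h).episode ((ucbState σ h).served i)
      ((ucbState σ h).sold i)
    have := hv i
    rw [currentEstimate]
    linarith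
  have hL := logFactor_nonneg N T
  have hw : 0 ≤ 3 * √(v i * (logFactor N T / (ucbState σ h).served i))
      + 5 * (logFactor N T / (ucbState σ h).served i) := by positivity
  by_cases h0 : (ucbState σ h).served i = 0
  · have : ¬ 1 ≤ (ucbState σ h).served i := by omega
    rw [if_pos h0, if_neg fun hc => this hc.1]
    linarith
  · rw [if_neg h0, zero_add]
    split_ifs with hov
    · linarith
    · have hep : (ucbState σ h).episode ≤ T := (ucbState_episode_le σ h).trans hT
      have hmono := logFactor_mono N hep
      have hvi := hv i
      have h1 := optimisticEstimate_sub_le hvi h0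
        (not_lt.1 fun hlt => hov ⟨by omega, hlt⟩)
      refine h1.trans ?_
      change 3 * √(v i * (logFactor N (ucbState σ h).episode / (ucbState σ h).served i))
        + 5 * (logFactor N (ucbState σ h).episode / (ucbState σ h).served i) ≤ _
      rw [add_zero]
      gcongr

theorem optValue_sub_le_two_mul {N : ℕ} {U : (ℝ → ℝ) → ℝ} {γ₁ : ℝ} (hU : RiskBounded U γ₁)
    {r v : Fin N → ℝ} (hr : ∀ i, 0 ≤ r i ∧ r i ≤ 1) (hv : ∀ i, 0 ≤ v i) (K : ℕ)
    (S : Finset (Fin N)) : optValue U r v K - U (profitCDF r v S) ≤ 2 * γ₁ := by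
  have h1 : optValue U r v K ≤ γ₁ := Finset.sup'_le _ _ fun S _ =>
    (abs_le.1 (hU _ (profitCDF_mem_cdfUnit hr hv S))).2
  have h2 := (abs_le.1 (hU _ (profitCDF_mem_cdfUnit hr hv S))).1
  linarith

/-- The regret of one step. -/
theorem step_regret_le {N K T : ℕ} {r v : Fin N → ℝ} (hr : ∀ i, 0 ≤ r i ∧ r i ≤ 1)
    (hv : ∀ i, 0 ≤ v i) (hv1 : ∀ i, v i ≤ 1) {U : (ℝ → ℝ) → ℝ} {γ₁ γ₂ : ℝ} (hγ₁ : 0 ≤ γ₁)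
    (hγ₂ : 0 ≤ γ₂) (hq : RiskQuasiconvex U) (hb : RiskBounded U γ₁) (hl : RiskLipschitz U r γ₂)
    {σ : SelectionRule N} (hσ : IsArgmaxRule U r K σ) {h : History N} (hT : h.length < T) :
    optValue U r v K - U (profitCDF r v (riskAwareUCB σ h))
      ≤ (2 * γ₁ * (N + 1)) * (∑ i, (if 1 ≤ (ucbState σ h).served i
            ∧ Underestimated (v i) N (ucbState σ h).episode ((ucbState σ h).served i)
              ((ucbState σ h).sold i) then 1 else 0)
            / (1 + ∑ j ∈ (ucbState σ h).offer, v j))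
        + γ₂ * ((∑ i ∈ (ucbState σ h).offer, ((if (ucbState σ h).served i = 0 then 1 else 0)
          + 3 * √(v i * (logFactor N T / (ucbState σ h).served i))
          + 5 * (logFactor N T / (ucbState σ h).served i)))
            / (1 + ∑ j ∈ (ucbState σ h).offer, v j)
          + ∑ i, (if 1 ≤ (ucbState σ h).served i
            ∧ Oversold (v i) N (ucbState σ h).episode ((ucbState σ h).served i)
              ((ucbState σ h).sold i) then 1 else 0)
            / (1 + ∑ j ∈ (ucbState σ h).offer, v j)) := by
  have hD := one_add_sum_pos hv (ucbState σ h).offer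
  have hL := logFactor_nonneg N T
  set D := 1 + ∑ j ∈ (ucbState σ h).offer, v j with hDdef
  have hite : ∀ p : Prop, [Decidable p] → (0 : ℝ) ≤ if p then 1 else 0 := by
    intro p _; split_ifs <;> norm_num
  have hw : ∀ i, 0 ≤ (if (ucbState σ h).served i = 0 then (1 : ℝ) else 0)
      + 3 * √(v i * (logFactor N T / (ucbState σ h).served i))
      + 5 * (logFactor N T / (ucbState σ h).served i) := fun i => by
    have := hite ((ucbState σ h).served i = 0)
    positivity
  by_cases hbad : ∃ i, 1 ≤ (ucbState σ h).served i ∧ Underestimated (v i) N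
      (ucbState σ h).episode ((ucbState σ h).served i) ((ucbState σ h).sold i)
  · obtain ⟨i, hi⟩ := hbad
    have hDN : D ≤ N + 1 := by
      have : ∑ j ∈ (ucbState σ h).offer, v j ≤ ∑ j : Fin N, (1 : ℝ) :=
        (Finset.sum_le_sum fun j _ => hv1 j).trans
          (Finset.sum_le_sum_of_subset_of_nonneg (Finset.subset_univ _) fun _ _ _ => zero_le_one)
      simp only [Finset.sum_const, Finset.card_univ, Fintype.card_fin, nsmul_eq_mul,
        mul_one] at this
      linarith
    have h1 : 1 / D ≤ ∑ i, (if 1 ≤ (ucbState σ h).served i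
        ∧ Underestimated (v i) N (ucbState σ h).episode ((ucbState σ h).served i)
          ((ucbState σ h).sold i) then (1 : ℝ) else 0) / D := by
      refine le_trans ?_ (Finset.single_le_sum
        (fun j _ => div_nonneg (hite _) hD.le) (Finset.mem_univ i))
      rw [if_pos hi]
    have h2 : 2 * γ₁ ≤ (2 * γ₁ * (N + 1)) * (1 / D) := by
      rw [mul_one_div, le_div_iff₀ hD]
      gcongr
    refine (optValue_sub_le_two_mul hb hr hv K _).trans (h2.trans ?_)
    refine le_add_of_le_of_nonneg (by gcongr) (mul_nonneg hγ₂ (add_nonneg ?_ ?_))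
    · exact div_nonneg (Finset.sum_nonneg fun i _ => hw i) hD.le
    · exact Finset.sum_nonneg fun i _ => div_nonneg (hite _) hD.le
  · have hle : ∀ i, v i ≤ currentEstimate σ h i := fun i =>
      le_currentEstimate hv1 σ h i fun hi => hbad ⟨i, hi⟩
    have h1 : optValue U r v K
        ≤ U (profitCDF r (currentEstimate σ h) (ucbState σ h).offer) := by
      obtain ⟨h₀, hh₀⟩ := ucbState_offer_eq σ h
      rw [hh₀]
      exact optValue_le_of_le hq hr hv hle (hσ h₀ _).2
    have h2 := hl v (currentEstimate σ h) (ucbState σ h).offer hv hle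
      fun i => optimisticEstimate_le_one _ _ _ _
    refine le_add_of_nonneg_of_le (mul_nonneg (by positivity)
      (Finset.sum_nonneg fun i _ => div_nonneg (hite _) hD.le)) ?_
    have h3 : ∑ i ∈ (ucbState σ h).offer, (currentEstimate σ h i - v i) ≤
        ∑ i ∈ (ucbState σ h).offer, ((if (ucbState σ h).served i = 0 then 1 else 0)
          + 3 * √(v i * (logFactor N T / (ucbState σ h).served i))
          + 5 * (logFactor N T / (ucbState σ h).served i))
        + ∑ i, (if 1 ≤ (ucbState σ h).served i
            ∧ Oversold (v i) N (ucbState σ h).episode ((ucbState σ h).served i)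
              ((ucbState σ h).sold i) then 1 else 0) := by
      refine (Finset.sum_le_sum fun i _ => currentEstimate_sub_le hv σ hT i).trans ?_
      rw [Finset.sum_add_distrib]
      refine add_le_add le_rfl (Finset.sum_le_sum_of_subset_of_nonneg (Finset.subset_univ _)
        fun i _ _ => ?_)
      split_ifs <;> norm_num
    rw [← Finset.sum_div, ← add_div, mul_div_assoc', mul_comm γ₂, mul_div_assoc, mul_comm]
    calc optValue U r v K - U (profitCDF r v (riskAwareUCB σ h))
        ≤ γ₂ / D * ∑ i ∈ (ucbState σ h).offer, (currentEstimate σ h i - v i) := by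
          refine le_trans ?_ h2
          exact sub_le_sub_right h1 _
      _ ≤ _ := by gcongr

theorem expectedTotal_underestimated_le {N : ℕ} (hN : 1 ≤ N) {v : Fin N → ℝ}
    (hv : ∀ i, 0 ≤ v i) (hv1 : ∀ i, v i ≤ 1) (σ : SelectionRule N) (i : Fin N) (T : ℕ) :
    expectedTotal v (riskAwareUCB σ) (fun h => (if 1 ≤ (ucbState σ h).served i
        ∧ Underestimated (v i) N (ucbState σ h).episode ((ucbState σ h).served i)
          ((ucbState σ h).sold i) then 1 else 0)
        / (1 + ∑ j ∈ (ucbState σ h).offer, v j)) T [] ≤ 1 / (2 * (N : ℝ)) := by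
  refine expectedTotal_tail_le hN hv σ i (Underestimated (v i) N) (fun ℓ n _ hn => ?_) T
  rw [pow_three_eq_exp_logFactor]
  exact exists_exp_lower_tail (hv i) (hv1 i) (logFactor_nonneg N ℓ) hn

theorem expectedTotal_oversold_le {N : ℕ} (hN : 1 ≤ N) {v : Fin N → ℝ}
    (hv : ∀ i, 0 ≤ v i) (hv1 : ∀ i, v i ≤ 1) (σ : SelectionRule N) (i : Fin N) (T : ℕ) :
    expectedTotal v (riskAwareUCB σ) (fun h => (if 1 ≤ (ucbState σ h).served i
        ∧ Oversold (v i) N (ucbState σ h).episode ((ucbState σ h).served i)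
          ((ucbState σ h).sold i) then 1 else 0)
        / (1 + ∑ j ∈ (ucbState σ h).offer, v j)) T [] ≤ 1 / (2 * (N : ℝ)) := by
  refine expectedTotal_tail_le hN hv σ i (Oversold (v i) N) (fun ℓ n _ hn => ?_) T
  rw [pow_three_eq_exp_logFactor]
  exact exists_exp_upper_tail (hv i) (hv1 i) (logFactor_nonneg N ℓ) hn

theorem regret_riskAwareUCB_le {N K T : ℕ} (hN : 1 ≤ N) (hT : 1 ≤ T) {r v : Fin N → ℝ}
    (hr : ∀ i, 0 ≤ r i ∧ r i ≤ 1) (hv : ∀ i, 0 ≤ v i) (hv1 : ∀ i, v i ≤ 1)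
    {U : (ℝ → ℝ) → ℝ} {γ₁ γ₂ : ℝ} (hγ₁ : 0 ≤ γ₁) (hγ₂ : 0 ≤ γ₂) (hq : RiskQuasiconvex U)
    (hb : RiskBounded U γ₁) (hl : RiskLipschitz U r γ₂) {σ : SelectionRule N}
    (hσ : IsArgmaxRule U r K σ) :
    regret U r v K T (riskAwareUCB σ) ≤ γ₁ * (N + 1)
      + γ₂ * (N + 6 * √(logFactor N T) * √((N : ℝ) * T)
        + 5 * logFactor N T * N * (1 + Real.log T) + 1 / 2) := by
  have hN0 : (N : ℝ) ≠ 0 := by positivity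
  have hhalf : ∑ _i : Fin N, 1 / (2 * (N : ℝ)) = 1 / 2 := by
    rw [Finset.sum_const, Finset.card_univ, Fintype.card_fin, nsmul_eq_mul]
    field_simp
  rw [regret_eq_expectedTotal U r hv]
  refine (expectedTotal_mono hv _ fun h hh =>
    step_regret_le hr hv hv1 hγ₁ hγ₂ hq hb hl hσ hh).trans ?_
  rw [expectedTotal_add, expectedTotal_mul, expectedTotal_mul, expectedTotal_add,
    expectedTotal_sum, expectedTotal_sum]
  have h1 := Finset.sum_le_sum fun (i : Fin N) (_ : i ∈ Finset.univ) =>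
    expectedTotal_underestimated_le hN hv hv1 σ i T
  have h2 := Finset.sum_le_sum fun (i : Fin N) (_ : i ∈ Finset.univ) =>
    expectedTotal_oversold_le hN hv hv1 σ i T
  have h3 := expectedTotal_width_le hN hT hv σ (logFactor_nonneg N T)
  rw [hhalf] at h1 h2
  refine add_le_add ?_ (mul_le_mul_of_nonneg_left (add_le_add h3 h2) hγ₂)
  refine (mul_le_mul_of_nonneg_left h1 (by positivity)).trans_eq ?_
  ring

theorem regret_terms_le {γ₁ γ₂ n R a b s l x : ℝ} (hγ₁ : 0 ≤ γ₁) (hγ₂ : 0 ≤ γ₂) (hR : 0 ≤ R)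
    (hn : 1 ≤ n) (hnR : n ≤ R) (ha : 0 ≤ a + b) (hax : a + b ≤ x) (hsx : s ≤ x)
    (hlx : l ≤ x) (hx : 1 ≤ x) :
    2 * γ₁ * (n + 1) * (a + b) + γ₂ * 24 * s * (2 * R + n) + γ₂ * 240 * l * (n * (a + (1 + b)))
      ≤ 600 * (γ₁ + γ₂) * R * x ^ 2 := by
  have hx0 : 0 ≤ x := by linarith
  have hxx : x ≤ x ^ 2 := by nlinarith
  have h1 : 2 * γ₁ * (n + 1) * (a + b) ≤ 4 * (γ₁ * R * x ^ 2) := by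
    calc 2 * γ₁ * (n + 1) * (a + b) ≤ 2 * γ₁ * (R + R) * x ^ 2 :=
          mul_le_mul (mul_le_mul_of_nonneg_left (by linarith) (by linarith)) (hax.trans hxx) ha
            (by positivity)
      _ = _ := by ring
  have h2 : γ₂ * 24 * s * (2 * R + n) ≤ 72 * (γ₂ * R * x ^ 2) := by
    calc γ₂ * 24 * s * (2 * R + n) ≤ γ₂ * 24 * x ^ 2 * (2 * R + R) :=
          mul_le_mul (mul_le_mul_of_nonneg_left (hsx.trans hxx) (by linarith)) (by linarith)
            (by linarith) (by positivity)
      _ = _ := by ring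
  have h3 : γ₂ * 240 * l * (n * (a + (1 + b))) ≤ 480 * (γ₂ * R * x ^ 2) := by
    calc γ₂ * 240 * l * (n * (a + (1 + b))) ≤ γ₂ * 240 * x * (R * (2 * x)) :=
          mul_le_mul (mul_le_mul_of_nonneg_left hlx (by linarith))
            (mul_le_mul hnR (by linarith) (by linarith) hR)
            (mul_nonneg (by linarith) (by linarith)) (by positivity)
      _ = _ := by ring
  have h4 : 0 ≤ γ₁ * R * x ^ 2 := by positivity
  have h5 : 0 ≤ γ₂ * R * x ^ 2 := by positivity
  linarith

end MNLBandit

theorem theorem1 :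
    ∃ C₁ C₂ C : ℝ, ∃ k : ℕ, 0 < C₁ ∧ 0 < C₂ ∧ 0 < C ∧
      ∀ (N K T : ℕ), 1 ≤ N → K ≤ N → 1 ≤ T →
      ∀ (r v : Fin N → ℝ), (∀ i, 0 < r i ∧ r i ≤ 1) → (∀ i, 0 ≤ v i ∧ v i ≤ 1) →
      ∀ (U : (ℝ → ℝ) → ℝ) (γ₁ γ₂ : ℝ), 0 ≤ γ₂ →
        MNLBandit.RiskQuasiconvex U → MNLBandit.RiskBounded U γ₁ →
        MNLBandit.RiskLipschitz U r γ₂ →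
      ∀ σ : MNLBandit.SelectionRule N, MNLBandit.IsArgmaxRule U r K σ →
        MNLBandit.regret U r v K T (MNLBandit.riskAwareUCB σ)
            ≤ 2 * γ₁ * (N + 1) * (Real.log T + Real.eulerMascheroniConstant)
              + γ₂ * C₁ * √(Real.log (√(N : ℝ) * T + 1)) * (2 * √((N : ℝ) * T) + N)
              + γ₂ * C₂ * Real.log (√(N : ℝ) * T + 1)
                  * (N * Real.log T + N * (1 + Real.eulerMascheroniConstant))
        ∧ MNLBandit.regret U r v K T (MNLBandit.riskAwareUCB σ)
            ≤ C * (γ₁ + γ₂) * √((N : ℝ) * T) * (1 + Real.log ((N : ℝ) * T)) ^ k := by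
  refine ⟨24, 240, 600, 2, by norm_num, by norm_num, by norm_num, ?_⟩
  intro N K T hN _ hT r v hr' hv' U γ₁ γ₂ hγ₂ hq hb hl σ hσ
  have hr : ∀ i, 0 ≤ r i ∧ r i ≤ 1 := fun i => ⟨(hr' i).1.le, (hr' i).2⟩
  have hv : ∀ i, 0 ≤ v i := fun i => (hv' i).1
  have hγ₁ : 0 ≤ γ₁ :=
    (abs_nonneg _).trans (hb _ (MNLBandit.profitCDF_mem_cdfUnit hr hv ∅))
  have hmain := MNLBandit.regret_riskAwareUCB_le (K := K) hN hT hr hv (fun i => (hv' i).2) hγ₁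
    hγ₂ hq hb hl hσ
  have htriv : MNLBandit.regret U r v K T (MNLBandit.riskAwareUCB σ) ≤ T * (2 * γ₁) := by
    rw [MNLBandit.regret_eq_expectedTotal U r hv]
    exact MNLBandit.expectedTotal_le_of_cost_le hv _
      (fun h => MNLBandit.optValue_sub_le_two_mul hb hr hv K _) T
  have hN1 : (1 : ℝ) ≤ N := by exact_mod_cast hN
  have hT1 : (1 : ℝ) ≤ T := by exact_mod_cast hT
  have hlogT : 0 ≤ Real.log T := Real.log_nonneg hT1
  have hγlow := Real.one_half_lt_eulerMascheroniConstant
  have hγhigh := Real.eulerMascheroniConstant_lt_two_thirds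
  have hsN : 1 ≤ √(N : ℝ) := Real.one_le_sqrt.2 hN1
  rw [MNLBandit.logFactor] at hmain
  set l := Real.log (√(N : ℝ) * T + 1) with hl_def
  set R := √((N : ℝ) * T) with hR
  set γ := Real.eulerMascheroniConstant
  have hl_half : 1 / 4 ≤ l := by
    have h1 : (2 : ℝ) ≤ √(N : ℝ) * T + 1 := by nlinarith
    have := Real.log_le_log (by norm_num) h1
    linarith [Real.log_two_gt_d9]
  have hsl : 1 / 2 ≤ √l := Real.le_sqrt_of_sq_le (by linarith)
  have hR0 : 0 ≤ R := Real.sqrt_nonneg _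
  have hs48 : √(48 * l) ≤ 7 * √l := by
    rw [Real.sqrt_mul (by norm_num)]
    gcongr
    exact Real.sqrt_le_iff.2 ⟨by norm_num, by norm_num⟩
  have hfirst : MNLBandit.regret U r v K T (MNLBandit.riskAwareUCB σ)
      ≤ 2 * γ₁ * (N + 1) * (Real.log T + γ) + γ₂ * 24 * √l * (2 * R + N)
        + γ₂ * 240 * l * (N * Real.log T + N * (1 + γ)) := by
    have h1 : γ₁ * (N + 1) ≤ 2 * γ₁ * (N + 1) * (Real.log T + γ) := by
      have : 0 ≤ γ₁ * (N + 1) := by positivity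
      nlinarith
    have h2 : N + 6 * √(48 * l) * R + 5 * (48 * l) * N * (1 + Real.log T) + 1 / 2
        ≤ 24 * √l * (2 * R + N) + 240 * l * (N * Real.log T + N * (1 + γ)) := by
      have h3 : 6 * √(48 * l) * R ≤ 6 * (7 * √l) * R := by gcongr
      have h4 : 1 / 2 * (N : ℝ) ≤ √l * N := by gcongr
      have h5 : 0 ≤ l * N * γ := by positivity
      have h6 : 0 ≤ √l * R := by positivity
      nlinarith
    have h7 := mul_le_mul_of_nonneg_left h2 hγ₂
    linarith
  refine ⟨hfirst, ?_⟩
  have hNT : (1 : ℝ) ≤ N * T := one_le_mul_of_one_le_of_one_le hN1 hT1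
  set ℒ := 1 + Real.log ((N : ℝ) * T) with hℒ
  have hℒ1 : 1 ≤ ℒ := by linarith [Real.log_nonneg hNT]
  have hRsq : R ^ 2 = N * T := Real.sq_sqrt (by linarith)
  have hsum : 0 ≤ γ₁ + γ₂ := by linarith
  rcases le_total T N with hle | hle
  · have hTN : (T : ℝ) ≤ N := by exact_mod_cast hle
    have hTR : (T : ℝ) ≤ R := Real.le_sqrt_of_sq_le (by nlinarith)
    calc MNLBandit.regret U r v K T (MNLBandit.riskAwareUCB σ) ≤ T * (2 * γ₁) := htriv
      _ ≤ R * (2 * γ₁) := by gcongr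
      _ ≤ R * (600 * (γ₁ + γ₂)) := mul_le_mul_of_nonneg_left (by linarith) hR0
      _ = 600 * (γ₁ + γ₂) * R * 1 := by ring
      _ ≤ 600 * (γ₁ + γ₂) * R * ℒ ^ 2 := by gcongr; exact one_le_pow₀ hℒ1
  · have hTN : (N : ℝ) ≤ T := by exact_mod_cast hle
    have hNR : (N : ℝ) ≤ R := Real.le_sqrt_of_sq_le (by nlinarith)
    have hlogTℒ : Real.log T ≤ ℒ - 1 := by
      have := Real.log_le_log (by linarith) (by nlinarith : (T : ℝ) ≤ N * T)
      linarith
    have hlℒ : l ≤ ℒ := by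
      have h1 : √(N : ℝ) ≤ N := Real.sqrt_le_iff.2 ⟨by linarith, by nlinarith⟩
      have h2 : √(N : ℝ) * T + 1 ≤ 2 * (N * T) := by nlinarith
      have h3 := Real.log_le_log (by positivity) h2
      rw [Real.log_mul (by norm_num) (by linarith)] at h3
      linarith [Real.log_two_lt_d9]
    have hslℒ : √l ≤ ℒ := Real.sqrt_le_iff.2 ⟨by linarith, by nlinarith⟩
    have hlogγ : Real.log T + γ ≤ ℒ := by linarith
    refine hfirst.trans ?_
    rw [← mul_add]
    exact MNLBandit.regret_terms_le hγ₁ hγ₂ (by linarith) hN1 hNR (by linarith) hlogγ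
      hslℒ hlℒ hℒ1
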